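/- Let $A\in\mathbb{R}^{m\times n}$ with rows $a_1^\top,\dots,a_m^\top$, let $b\in\mathbb{R}^m$, and suppose that the polytope $K=\{x\in\mathbb{R}^n : Ax\ge b\}$ is bounded and full-dimensional (it has nonempty interior $\operatorname{int}K$). For $x\in\operatorname{int}K$ let $$H(x)=\sum_{i=1}^m \frac{a_i a_i^\top}{(a_i^\top x-b_i)^2},\qquad F(x)=\tfrac12\ln\det H(x)$$ (terms with $a_i=0$ are read as $0$), so that $H$ is the Hessian of the log-barrier $\sum_{i=1}^m-\ln(a_i^\top x-b_i)$ and $F$ is the volumetric function. For $x_0\in\mathbb{R}^n$ and a positive semidefinite $M\in\mathbb{R}^{n\times n}$ let $$E(x_0,M)=\{x\in x_0+W_M : (x-x_0)^\top M(x-x_0)\le 1\},$$ where $W_M$ is the span of the eigenvectors of $M$ with nonzero eigenvalue, and for $c\ge 0$ let $c\cdot E(x_0,M)=\{x_0+c(y-x_0): y\in E(x_0,M)\}$ be its dilation about its center. Then: 1. for every $x\in\operatorname{int}K$, $E(x,H(x))\subseteq K$; 2. $F$ attains its minimum on $\operatorname{int}K$, and for every minimizer $\mathrm{vc}(K)$ of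 $F$ (volumetric center of $K$), $$K\subseteq 2m^{1.5}n\cdot E\big(\mathrm{vc}(K),H(\mathrm{vc}(K))\big).$$ -/

import Mathlib

open Matrix

namespace LogBarrier

variable {m n : ℕ}

/-- The polyhedron `{x : A x ≥ b}` in `ℝⁿ`, given by `m` linear constraints. -/
def polytope (A : Matrix (Fin m) (Fin n) ℝ) (b : Fin m → ℝ) : Set (Fin n → ℝ) :=
  {x | ∀ i, b i ≤ A i ⬝ᵥ x}

/-- The Hessian `H(x) = ∑ i, aᵢ aᵢᵀ / (aᵢᵀ x - bᵢ)²` of the logarithmic barrier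
`∑ i, - ln (aᵢᵀ x - bᵢ)`, where `aᵢᵀ` is the `i`-th row of `A`. It is meant at interior points of
the polytope, where `aᵢᵀ x - bᵢ > 0` for every `i` with `aᵢ ≠ 0`. -/
noncomputable def hessian (A : Matrix (Fin m) (Fin n) ℝ) (b : Fin m → ℝ) (x : Fin n → ℝ) :
    Matrix (Fin n) (Fin n) ℝ :=
  ∑ i, (1 / (A i ⬝ᵥ x - b i) ^ 2) • vecMulVec (A i) (A i)

/-- The volumetric function `F(x) = (1/2) ln det H(x)`. -/
noncomputable def volumetric (A : Matrix (Fin m) (Fin n) ℝ) (b : Fin m → ℝ) (x : Fin n → ℝ) : ℝ :=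
  (1 / 2) * Real.log (hessian A b x).det

/-- `v` is a volumetric center: a minimizer of the volumetric function. The minimum is over the
interior, the domain of `F` (which tends to `+∞` at the boundary of a bounded polytope). -/
def IsVolumetricCenter (A : Matrix (Fin m) (Fin n) ℝ) (b : Fin m → ℝ) (v : Fin n → ℝ) : Prop :=
  v ∈ interior (polytope A b) ∧ IsMinOn (volumetric A b) (interior (polytope A b)) v

/-- The span of the eigenvectors of `M` for nonzero eigenvalues. -/
def nonzeroEigenspan (M : Matrix (Fin n) (Fin n) ℝ) : Submodule ℝ (Fin n → ℝ) :=
  Submodule.span ℝ {w | ∃ μ : ℝ, μ ≠ 0 ∧ M *ᵥ w = μ • w}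

/-- The (not necessarily full-rank) ellipsoid
`E(x₀, M) = {x ∈ x₀ + W_M : (x - x₀)ᵀ M (x - x₀) ≤ 1}`. -/
def ellipsoid (x₀ : Fin n → ℝ) (M : Matrix (Fin n) (Fin n) ℝ) : Set (Fin n → ℝ) :=
  {x | x - x₀ ∈ nonzeroEigenspan M ∧ (x - x₀) ⬝ᵥ (M *ᵥ (x - x₀)) ≤ 1}

/-- The ellipsoid `c · E(x₀, M)`: the dilation of `E(x₀, M)` by `c` about its center `x₀`. -/
def scaledEllipsoid (c : ℝ) (x₀ : Fin n → ℝ) (M : Matrix (Fin n) (Fin n) ℝ) : Set (Fin n → ℝ) :=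
  (fun y => x₀ + c • (y - x₀)) '' ellipsoid x₀ M

end LogBarrier

/-! Let `s_i` be the slacks at a center `v` and `σ_i` the leverage scores, whose sum is `n`. For `y`
in `K` put `h = y - v`, `t_i = a_iᵀh / s_i`, so that `hᵀHh = ∑ t_i² = T`. The outer inclusion says
`T ≤ 4m³n²`. It follows from three facts: `t_i ≥ -1` because `y ∈ K`; `t_i² ≤ σ_i T` by
Cauchy–Schwarz (`sq_div_slack_le`); `∑ σ_i t_i = 0` by stationarity of `F`
(`sum_leverage_mul_div_slack_eq_zero`). Indices with `σ_i < 1/(2m)` carry at most half of `T`; on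
the others, `∑ σ_i (1 + t_i) = n` with nonnegative terms controls the `t_i`
(`sum_sq_le_of_sum_mul_eq_zero`).

The inner inclusion holds because `T ≤ 1` forces every `|t_i| ≤ 1`. A minimizer exists because a
slack tending to zero drives `det H` to infinity, the other slacks being bounded above
(`exists_slack_lower_bound`). -/

namespace Matrix

variable {ι : Type*} [Fintype ι] [DecidableEq ι]

/-! ### Determinant and Cauchy–Schwarz inequalities for positive matrices -/

open scoped MatrixOrder Matrix.Norms.L2Operator in
theorem PosSemidef.exists_eq_transpose_mul_self {X : Matrix ι ι ℝ} (hX : X.PosSemidef) :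
    ∃ B : Matrix ι ι ℝ, X = Bᵀ * B := by
  obtain ⟨B, hB⟩ := CStarAlgebra.nonneg_iff_eq_star_mul_self.mp hX.nonneg
  exact ⟨B, by rw [hB, star_eq_conjTranspose, conjTranspose_eq_transpose_of_trivial]⟩

/-- Apply `λ ≤ exp (λ - 1)` to each eigenvalue and multiply. -/
theorem PosSemidef.det_le_exp_trace_sub_card {Z : Matrix ι ι ℝ} (hZ : Z.PosSemidef) :
    Z.det ≤ Real.exp (Z.trace - Fintype.card ι) := by
  have hd : Z.det = ∏ i, hZ.1.eigenvalues i := hZ.1.det_eq_prod_eigenvalues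
  have ht : Z.trace = ∑ i, hZ.1.eigenvalues i := hZ.1.trace_eq_sum_eigenvalues
  have hs : ∑ i, hZ.1.eigenvalues i - Fintype.card ι = ∑ i, (hZ.1.eigenvalues i - 1) := by
    simp [Finset.sum_sub_distrib]
  rw [hd, ht, hs, Real.exp_sum]
  refine Finset.prod_le_prod (fun i _ => hZ.eigenvalues_nonneg i) fun i _ => ?_
  linarith [Real.add_one_le_exp (hZ.1.eigenvalues i - 1)]

/-- The first-order upper bound for the concave function `log det`, in exponential form. -/
theorem PosDef.det_le_det_mul_exp {X Y : Matrix ι ι ℝ} (hX : X.PosDef) (hY : Y.PosSemidef) :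
    Y.det ≤ X.det * Real.exp ((X⁻¹ * Y).trace - Fintype.card ι) := by
  -- Conjugation by a factor of `X⁻¹ = Bᵀ B` reduces to the case `X = 1`.
  obtain ⟨B, hB⟩ := hX.inv.posSemidef.exists_eq_transpose_mul_self
  have hZ := (hY.mul_mul_conjTranspose_same B).det_le_exp_trace_sub_card
  rw [conjTranspose_eq_transpose_of_trivial] at hZ
  have ht : (B * Y * Bᵀ).trace = (X⁻¹ * Y).trace := by
    rw [trace_mul_comm, hB, Matrix.mul_assoc]
  have hd : (B * Y * Bᵀ).det = X.det⁻¹ * Y.det := by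
    have h : X.det⁻¹ = Bᵀ.det * B.det := by
      rw [← det_mul, ← hB, det_nonsing_inv, Ring.inverse_eq_inv']
    rw [det_mul, det_mul, h]
    ring
  rw [ht, hd, inv_mul_le_iff₀ hX.det_pos] at hZ
  exact hZ

/-- With `g = X⁻¹ a`, the form `X` is nonnegative at `h - t • g` for all `t`, so the discriminant in
`t` is nonpositive. -/
theorem PosDef.sq_dotProduct_le {X : Matrix ι ι ℝ} (hX : X.PosDef) (a h : ι → ℝ) :
    (a ⬝ᵥ h) ^ 2 ≤ (a ⬝ᵥ (X⁻¹ *ᵥ a)) * (h ⬝ᵥ (X *ᵥ h)) := by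
  have hg : X *ᵥ (X⁻¹ *ᵥ a) = a := by
    rw [mulVec_mulVec, mul_nonsing_inv _ hX.det_pos.ne'.isUnit, one_mulVec]
  generalize X⁻¹ *ᵥ a = g at hg ⊢
  have hsymm : g ⬝ᵥ (X *ᵥ h) = h ⬝ᵥ a := by
    rw [dotProduct_mulVec, ← mulVec_transpose,
      ← conjTranspose_eq_transpose_of_trivial, hX.1.eq, hg, dotProduct_comm]
  have key : ∀ t : ℝ, 0 ≤ (a ⬝ᵥ g) * (t * t) + (-2 * (a ⬝ᵥ h)) * t + h ⬝ᵥ (X *ᵥ h) := by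
    intro t
    have := hX.posSemidef.dotProduct_mulVec_nonneg (h - t • g)
    simp only [star_trivial, mulVec_sub, mulVec_smul, dotProduct_sub, sub_dotProduct,
      dotProduct_smul, smul_dotProduct, smul_eq_mul, hg, hsymm] at this
    rw [dotProduct_comm h a, dotProduct_comm g a] at this
    linarith
  have := discrim_le_zero key
  rw [discrim] at this
  linarith

end Matrix

/-! ### Weighted Gram matrices -/

namespace LogBarrier

variable {m n : ℕ}

/-- The weighted Gram matrix `∑ i, wᵢ aᵢ aᵢᵀ` of the rows of `A`. -/
def weightedGram (A : Matrix (Fin m) (Fin n) ℝ) (w : Fin m → ℝ) : Matrix (Fin n) (Fin n) ℝ :=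
  ∑ i, w i • vecMulVec (A i) (A i)

variable {A : Matrix (Fin m) (Fin n) ℝ} {b : Fin m → ℝ}

theorem hessian_eq_weightedGram (x : Fin n → ℝ) :
    hessian A b x = weightedGram A (fun i => 1 / (A i ⬝ᵥ x - b i) ^ 2) := rfl

theorem weightedGram_mulVec (w : Fin m → ℝ) (h : Fin n → ℝ) :
    weightedGram A w *ᵥ h = ∑ i, (w i * (A i ⬝ᵥ h)) • A i := by
  rw [weightedGram, sum_mulVec]
  refine Finset.sum_congr rfl fun i _ => ?_
  rw [smul_mulVec, vecMulVec_mulVec, op_smul_eq_smul, smul_smul]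

theorem dotProduct_weightedGram_mulVec (w : Fin m → ℝ) (h : Fin n → ℝ) :
    h ⬝ᵥ (weightedGram A w *ᵥ h) = ∑ i, w i * (A i ⬝ᵥ h) ^ 2 := by
  rw [weightedGram_mulVec, dotProduct_sum]
  refine Finset.sum_congr rfl fun i _ => ?_
  rw [dotProduct_smul, dotProduct_comm, smul_eq_mul]
  ring

theorem trace_mul_weightedGram (M : Matrix (Fin n) (Fin n) ℝ) (w : Fin m → ℝ) :
    (M * weightedGram A w).trace = ∑ i, w i * (A i ⬝ᵥ (M *ᵥ A i)) := by
  rw [weightedGram, Finset.mul_sum, trace_sum]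
  refine Finset.sum_congr rfl fun i _ => ?_
  rw [mul_smul_comm, trace_smul, mul_vecMulVec, trace_vecMulVec, dotProduct_comm, smul_eq_mul]

theorem isHermitian_weightedGram (w : Fin m → ℝ) : (weightedGram A w).IsHermitian := by
  rw [Matrix.IsHermitian, conjTranspose_eq_transpose_of_trivial, weightedGram, transpose_sum]
  simp [transpose_smul, transpose_vecMulVec]

theorem posSemidef_weightedGram {w : Fin m → ℝ} (hw : ∀ i, A i ≠ 0 → 0 ≤ w i) :
    (weightedGram A w).PosSemidef := by
  refine .of_dotProduct_mulVec_nonneg (isHermitian_weightedGram w) fun h => ?_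
  rw [star_trivial, dotProduct_weightedGram_mulVec]
  refine Finset.sum_nonneg fun i _ => ?_
  by_cases hi : A i = 0
  · simp [hi]
  · exact mul_nonneg (hw i hi) (sq_nonneg _)

theorem posDef_weightedGram (hA : ∀ h, (∀ i, A i ⬝ᵥ h = 0) → h = 0) {w : Fin m → ℝ}
    (hw : ∀ i, A i ≠ 0 → 0 < w i) : (weightedGram A w).PosDef := by
  refine .of_dotProduct_mulVec_pos (isHermitian_weightedGram w) fun h hh => ?_
  rw [star_trivial, dotProduct_weightedGram_mulVec]
  have hnn : ∀ i ∈ Finset.univ, 0 ≤ w i * (A i ⬝ᵥ h) ^ 2 := fun i _ => by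
    by_cases hi : A i = 0
    · simp [hi]
    · exact mul_nonneg (hw i hi).le (sq_nonneg _)
  refine (Finset.sum_nonneg hnn).lt_of_ne' fun h0 => hh (hA h fun i => ?_)
  have := (Finset.sum_eq_zero_iff_of_nonneg hnn).1 h0 i (Finset.mem_univ i)
  by_cases hi : A i = 0
  · simp [hi]
  · simpa [(hw i hi).ne'] using this

/-- By the first-order bound at `w'`, it suffices that `tr (G(w')⁻¹ G(w)) ≤ tr (G(w')⁻¹ G(w')) = n`,
which holds term by term. -/
theorem det_weightedGram_mono {w w' : Fin m → ℝ} (hw' : (weightedGram A w').PosDef)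
    (hw : ∀ i, A i ≠ 0 → 0 ≤ w i) (h : ∀ i, A i ≠ 0 → w i ≤ w' i) :
    (weightedGram A w).det ≤ (weightedGram A w').det := by
  refine (hw'.det_le_det_mul_exp (posSemidef_weightedGram hw)).trans
    (mul_le_of_le_one_right hw'.det_pos.le (Real.exp_le_one_iff.2 ?_))
  have hc : ((weightedGram A w')⁻¹ * weightedGram A w').trace = n := by
    rw [nonsing_inv_mul _ hw'.det_pos.ne'.isUnit, trace_one, Fintype.card_fin]
  rw [trace_mul_weightedGram] at hc ⊢
  rw [Fintype.card_fin, ← hc, sub_nonpos]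
  refine Finset.sum_le_sum fun i _ => ?_
  by_cases hi : A i = 0
  · simp [hi]
  · exact mul_le_mul_of_nonneg_right (h i hi)
      (by simpa using hw'.inv.posSemidef.dotProduct_mulVec_nonneg (A i))

theorem det_weightedGram_add_single {w : Fin m → ℝ} (hw : (weightedGram A w).PosDef)
    (i : Fin m) (c : ℝ) :
    (weightedGram A (w + Pi.single i c)).det =
      (weightedGram A w).det * (1 + c * (A i ⬝ᵥ ((weightedGram A w)⁻¹ *ᵥ A i))) := by
  have h : weightedGram A (w + Pi.single i c) =
      weightedGram A w + replicateCol Unit (c • A i) * replicateRow Unit (A i) := by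
    rw [← vecMulVec_eq, smul_vecMulVec]
    simp [weightedGram, add_smul, Finset.sum_add_distrib, Pi.single_apply, ite_smul]
  rw [h, det_add_replicateCol_mul_replicateRow hw.det_pos.ne'.isUnit]
  congr 1
  rw [det_unique, Matrix.add_apply, one_apply_eq, Matrix.mul_assoc, ← replicateCol_mulVec,
    replicateRow_mul_replicateCol_apply, mulVec_smul, dotProduct_smul, smul_eq_mul]

theorem nonzeroEigenspan_eq_top {M : Matrix (Fin n) (Fin n) ℝ} (hM : M.PosDef) :
    nonzeroEigenspan M = ⊤ := by
  let e := hM.1.eigenvectorBasis.toBasis.map (WithLp.linearEquiv 2 ℝ (Fin n → ℝ))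
  rw [eq_top_iff, ← e.span_eq, nonzeroEigenspan]
  refine Submodule.span_mono ?_
  rintro _ ⟨j, rfl⟩
  refine ⟨hM.1.eigenvalues j, (hM.eigenvalues_pos j).ne', ?_⟩
  simpa [e] using hM.1.mulVec_eigenvectorBasis j

/-! ### Slacks, interior points and the inner ellipsoid -/

theorem isClosed_polytope (A : Matrix (Fin m) (Fin n) ℝ) (b : Fin m → ℝ) :
    IsClosed (polytope A b) := by
  simp only [polytope, Set.ofPred_forall]
  exact isClosed_iInter fun i => isClosed_le continuous_const (by fun_prop)

/-- A small step along `-A i` stays in the polytope yet strictly decreases the slack. -/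
theorem slack_pos_of_mem_interior {x : Fin n → ℝ} (hx : x ∈ interior (polytope A b)) {i : Fin m}
    (hi : A i ≠ 0) : 0 < A i ⬝ᵥ x - b i := by
  have hc : Filter.Tendsto (fun t : ℝ => x - t • A i) (nhdsWithin 0 (Set.Ioi 0)) (nhds x) := by
    have : Continuous fun t : ℝ => x - t • A i := by fun_prop
    simpa using (this.tendsto 0).mono_left nhdsWithin_le_nhds
  obtain ⟨t, ht, ht0⟩ :=
    ((hc.eventually (mem_interior_iff_mem_nhds.1 hx)).and self_mem_nhdsWithin).exists
  have h1 : b i ≤ A i ⬝ᵥ (x - t • A i) := ht i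
  have h2 : 0 < A i ⬝ᵥ A i := by simpa using dotProduct_star_self_pos_iff.2 hi
  rw [dotProduct_sub, dotProduct_smul, smul_eq_mul] at h1
  have := mul_pos (Set.mem_Ioi.1 ht0) h2
  linarith

theorem mem_interior_of_slack_pos {x : Fin n → ℝ} (hx : x ∈ polytope A b)
    (h : ∀ i, A i ≠ 0 → 0 < A i ⬝ᵥ x - b i) : x ∈ interior (polytope A b) := by
  rw [mem_interior_iff_mem_nhds]
  have : ∀ᶠ y in nhds x, ∀ i, b i ≤ A i ⬝ᵥ y := by
    refine Filter.eventually_all.2 fun i => ?_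
    by_cases hi : A i = 0
    · refine Filter.Eventually.of_forall fun y => ?_
      simpa [hi] using hx i
    · have hc : Continuous fun y : Fin n → ℝ => A i ⬝ᵥ y := by fun_prop
      have h' : b i < A i ⬝ᵥ x := by linarith [h i hi]
      exact (hc.continuousAt.eventually_const_lt h').mono fun y hy => hy.le
  exact this

/-- Otherwise the polytope would contain a line in direction `h`. -/
theorem eq_zero_of_forall_dotProduct_eq_zero (hbdd : Bornology.IsBounded (polytope A b))
    (hne : (polytope A b).Nonempty) (h : Fin n → ℝ) (hh : ∀ i, A i ⬝ᵥ h = 0) : h = 0 := by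
  obtain ⟨x, hx⟩ := hne
  obtain ⟨R, hR⟩ := hbdd.exists_norm_le
  by_contra h0
  have hpos : 0 < ‖h‖ := norm_pos_iff.2 h0
  have hR' : ∀ t : ℝ, ‖x + t • h‖ ≤ R := fun t => hR _ fun i => by
    rw [dotProduct_add, dotProduct_smul, hh i, smul_zero, add_zero]
    exact hx i
  have h1 := hR' ((R + ‖x‖ + 1) / ‖h‖)
  have h2 := norm_sub_le (x + ((R + ‖x‖ + 1) / ‖h‖) • h) x
  have hRx := (norm_nonneg _).trans h1
  rw [add_sub_cancel_left, norm_smul, Real.norm_of_nonneg (by positivity),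
    div_mul_cancel₀ _ hpos.ne'] at h2
  linarith

theorem posDef_hessian (hbdd : Bornology.IsBounded (polytope A b)) {x : Fin n → ℝ}
    (hx : x ∈ interior (polytope A b)) : (hessian A b x).PosDef :=
  posDef_weightedGram
    (eq_zero_of_forall_dotProduct_eq_zero hbdd ⟨x, interior_subset hx⟩)
    fun i hi => by have := slack_pos_of_mem_interior hx hi; positivity

theorem dotProduct_hessian_mulVec (x h : Fin n → ℝ) :
    h ⬝ᵥ (hessian A b x *ᵥ h) = ∑ i, ((A i ⬝ᵥ h) / (A i ⬝ᵥ x - b i)) ^ 2 := by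
  rw [hessian_eq_weightedGram, dotProduct_weightedGram_mulVec]
  refine Finset.sum_congr rfl fun i _ => ?_
  rw [div_pow]
  ring

theorem ellipsoid_subset_polytope {x : Fin n → ℝ} (hx : x ∈ interior (polytope A b)) :
    ellipsoid x (hessian A b x) ⊆ polytope A b := by
  rintro y ⟨-, hy⟩ i
  by_cases hi : A i = 0
  · simpa [hi] using interior_subset hx i
  have hs := slack_pos_of_mem_interior hx hi
  rw [dotProduct_hessian_mulVec] at hy
  have h1 : ((A i ⬝ᵥ (y - x)) / (A i ⬝ᵥ x - b i)) ^ 2 ≤ 1 :=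
    (Finset.single_le_sum (f := fun i => ((A i ⬝ᵥ (y - x)) / (A i ⬝ᵥ x - b i)) ^ 2)
      (fun _ _ => sq_nonneg _) (Finset.mem_univ i)).trans hy
  have h2 := (abs_le.1 ((sq_le_one_iff_abs_le_one _).1 h1)).1
  rw [le_div_iff₀ hs, dotProduct_sub] at h2
  linarith

/-! ### Existence of a volumetric center -/

theorem exists_slack_bound (hbdd : Bornology.IsBounded (polytope A b)) (i : Fin m) :
    ∃ R, 0 < R ∧ ∀ x ∈ polytope A b, A i ⬝ᵥ x - b i ≤ R := by
  have hK : IsCompact (polytope A b) :=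
    Metric.isCompact_of_isClosed_isBounded (isClosed_polytope A b) hbdd
  have hc : Continuous fun x : Fin n → ℝ => A i ⬝ᵥ x - b i := by fun_prop
  obtain ⟨R, hR⟩ := hK.bddAbove_image hc.continuousOn
  exact ⟨max R 1, by positivity, fun x hx => (hR ⟨x, hx, rfl⟩).trans (le_max_left _ _)⟩

/-- On a sublevel set of `det H` every nontrivial slack is bounded away from zero. -/
theorem exists_slack_lower_bound (hbdd : Bornology.IsBounded (polytope A b))
    (hne : (polytope A b).Nonempty) (D : ℝ) {i : Fin m} (hi : A i ≠ 0) :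
    ∃ ε, 0 < ε ∧ ∀ x ∈ interior (polytope A b), (hessian A b x).det ≤ D →
      ε ≤ A i ⬝ᵥ x - b i := by
  choose R hR0 hR using fun j => exists_slack_bound hbdd j
  set w : Fin m → ℝ := fun j => 1 / R j ^ 2 with hwdef
  have hw0 : ∀ j, 0 < w j := fun j => by have := hR0 j; positivity
  have hG : (weightedGram A w).PosDef :=
    posDef_weightedGram (eq_zero_of_forall_dotProduct_eq_zero hbdd hne) fun j _ => hw0 j
  set q := A i ⬝ᵥ ((weightedGram A w)⁻¹ *ᵥ A i)
  have hq : 0 < q := by simpa using hG.inv.dotProduct_mulVec_pos hi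
  set d := (weightedGram A w).det
  have hd : 0 < d := hG.det_pos
  -- Solves `d * (1 + (u - w i) * q) ≤ D` for `u = 1 / slack²`; the maximum with 1 ensures
  -- positivity.
  set C := max (w i + (D / d - 1) / q) 1
  refine ⟨1 / √C, by positivity, fun x hx hxD => ?_⟩
  have hs := slack_pos_of_mem_interior hx hi
  have hle : ∀ j, A j ≠ 0 → w j ≤ 1 / (A j ⬝ᵥ x - b j) ^ 2 := fun j hj => by
    have := slack_pos_of_mem_interior hx hj
    have := hR j x (interior_subset hx)
    simp only [hwdef]
    gcongr
  -- Lower every Hessian weight to `w j` except the `i`-th: the result is a rank-one update of a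
  -- fixed matrix.
  have hmono := det_weightedGram_mono
    (w := w + Pi.single (M := fun _ => ℝ) i (1 / (A i ⬝ᵥ x - b i) ^ 2 - w i))
    (posDef_hessian hbdd hx)
    (fun j hj => by
      rcases eq_or_ne j i with rfl | hji
      · simp only [Pi.add_apply, Pi.single_eq_same]
        have := sq_nonneg (A j ⬝ᵥ x - b j)
        rw [add_sub_cancel]
        positivity
      · simpa [hji] using (hw0 j).le)
    (fun j hj => by
      rcases eq_or_ne j i with rfl | hji
      · simp
      · simpa [hji] using hle j hj)
  rw [det_weightedGram_add_single hG] at hmono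
  have h1 := hmono.trans hxD
  have h2 : 1 / (A i ⬝ᵥ x - b i) ^ 2 ≤ C := by
    refine le_trans ?_ (le_max_left _ _)
    rw [← sub_le_iff_le_add', le_div_iff₀ hq, le_sub_iff_add_le, le_div_iff₀ hd]
    linarith
  have hC : 0 < C := by positivity
  have h3 : 1 / C ≤ (A i ⬝ᵥ x - b i) ^ 2 := by
    rw [div_le_iff₀ (by positivity)] at h2
    rw [div_le_iff₀ hC]
    linarith
  rw [← Real.sqrt_one, ← Real.sqrt_div zero_le_one]
  exact (Real.sqrt_le_left hs.le).2 h3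

theorem exists_isVolumetricCenter (hbdd : Bornology.IsBounded (polytope A b))
    (hfull : (interior (polytope A b)).Nonempty) : ∃ v, IsVolumetricCenter A b v := by
  obtain ⟨x₀, hx₀⟩ := hfull
  have hne : (polytope A b).Nonempty := ⟨x₀, interior_subset hx₀⟩
  have hex : ∀ i, ∃ ε : ℝ, A i ≠ 0 → 0 < ε ∧ ∀ x ∈ interior (polytope A b),
      (hessian A b x).det ≤ (hessian A b x₀).det → ε ≤ A i ⬝ᵥ x - b i := fun i => by
    by_cases hi : A i = 0
    · exact ⟨0, fun h => absurd hi h⟩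
    · obtain ⟨ε, hε⟩ := exists_slack_lower_bound hbdd hne (hessian A b x₀).det hi
      exact ⟨ε, fun _ => hε⟩
  choose ε hε using hex
  -- A compact subset of the interior containing the sublevel set of `x₀`.
  set C : Set (Fin n → ℝ) := polytope A b ∩ {x | ∀ i, A i ≠ 0 → ε i ≤ A i ⬝ᵥ x - b i}
  have hCsub : C ⊆ interior (polytope A b) := fun x hx =>
    mem_interior_of_slack_pos hx.1 fun i hi => (hε i hi).1.trans_le (hx.2 i hi)
  have hmem : ∀ x ∈ interior (polytope A b),
      (hessian A b x).det ≤ (hessian A b x₀).det → x ∈ C := fun x hx hd =>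
    ⟨interior_subset hx, fun i hi => (hε i hi).2 x hx hd⟩
  have hCc : IsCompact C := by
    refine (Metric.isCompact_of_isClosed_isBounded (isClosed_polytope A b) hbdd).inter_right ?_
    simp only [Set.ofPred_forall]
    exact isClosed_iInter fun i => isClosed_iInter fun _ =>
      isClosed_le continuous_const (by fun_prop)
  have hcont : ContinuousOn (fun x => (hessian A b x).det) C := by
    have : ContinuousOn (fun x => hessian A b x) C := by
      refine continuousOn_finsetSum _ fun i _ => ?_
      by_cases hi : A i = 0
      · simpa [hi] using continuousOn_const
      · have hsq : Continuous fun x : Fin n → ℝ => (A i ⬝ᵥ x - b i) ^ 2 := by fun_prop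
        refine ContinuousOn.smul (ContinuousOn.div continuousOn_const
          hsq.continuousOn fun x hx => ?_) continuousOn_const
        exact pow_ne_zero _ (slack_pos_of_mem_interior (hCsub hx) hi).ne'
    exact (Continuous.matrix_det continuous_id).comp_continuousOn this
  obtain ⟨v, hvC, hv⟩ := hCc.exists_isMinOn ⟨x₀, hmem x₀ hx₀ le_rfl⟩ hcont
  refine ⟨v, hCsub hvC, fun x hx => ?_⟩
  have hle : (hessian A b v).det ≤ (hessian A b x).det := by
    rcases le_total (hessian A b x).det (hessian A b x₀).det with h | h
    · exact hv (hmem x hx h)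
    · exact (hv (hmem x₀ hx₀ le_rfl)).trans h
  have := Real.log_le_log (posDef_hessian hbdd (hCsub hvC)).det_pos hle
  simp only [Set.mem_ofPred_eq, volumetric]
  linarith

/-! ### Leverage scores and stationarity -/

/-- The leverage score `σᵢ = aᵢᵀ H(x)⁻¹ aᵢ / (aᵢᵀ x - bᵢ)²`. -/
noncomputable def leverage (A : Matrix (Fin m) (Fin n) ℝ) (b : Fin m → ℝ) (x : Fin n → ℝ)
    (i : Fin m) : ℝ :=
  1 / (A i ⬝ᵥ x - b i) ^ 2 * (A i ⬝ᵥ ((hessian A b x)⁻¹ *ᵥ A i))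

theorem sum_leverage {x : Fin n → ℝ} (hH : (hessian A b x).PosDef) :
    ∑ i, leverage A b x i = n := by
  have := trace_mul_weightedGram (A := A) (hessian A b x)⁻¹
    (fun i => 1 / (A i ⬝ᵥ x - b i) ^ 2)
  rw [← hessian_eq_weightedGram, nonsing_inv_mul _ hH.det_pos.ne'.isUnit, trace_one,
    Fintype.card_fin] at this
  exact this.symm

theorem leverage_nonneg {x : Fin n → ℝ} (hH : (hessian A b x).PosDef) (i : Fin m) :
    0 ≤ leverage A b x i :=
  mul_nonneg (by positivity)
    (by simpa using hH.inv.posSemidef.dotProduct_mulVec_nonneg (A i))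

theorem sq_div_slack_le {x : Fin n → ℝ} (hH : (hessian A b x).PosDef) (h : Fin n → ℝ)
    (i : Fin m) :
    ((A i ⬝ᵥ h) / (A i ⬝ᵥ x - b i)) ^ 2 ≤
      leverage A b x i * (h ⬝ᵥ (hessian A b x *ᵥ h)) := by
  have := mul_le_mul_of_nonneg_left (hH.sq_dotProduct_le (A i) h)
    (by positivity : 0 ≤ 1 / (A i ⬝ᵥ x - b i) ^ 2)
  rw [leverage, div_pow]
  calc _ = _ := by ring
    _ ≤ _ := this
    _ = _ := by ring

/-- No derivative of `det` is needed: by the first-order bound, minimality of `det H` at `v` makes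
`tr (H(v)⁻¹ H(v + t h))` locally minimal at `t = 0`, and this trace is an explicit sum. -/
theorem sum_leverage_mul_div_slack_eq_zero (hbdd : Bornology.IsBounded (polytope A b))
    {v : Fin n → ℝ} (hv : IsVolumetricCenter A b v) (h : Fin n → ℝ) :
    ∑ i, leverage A b v i * ((A i ⬝ᵥ h) / (A i ⬝ᵥ v - b i)) = 0 := by
  have hH := posDef_hessian hbdd hv.1
  set q : Fin m → ℝ := fun i => A i ⬝ᵥ ((hessian A b v)⁻¹ *ᵥ A i) with hq
  set φ : ℝ → ℝ := fun t => ∑ i, 1 / (A i ⬝ᵥ (v + t • h) - b i) ^ 2 * q i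
  have htrace : ∀ t, φ t = ((hessian A b v)⁻¹ * hessian A b (v + t • h)).trace := fun t => by
    rw [hessian_eq_weightedGram (v + t • h), trace_mul_weightedGram]
  have hφ0 : φ 0 = n := by
    rw [htrace, zero_smul, add_zero, nonsing_inv_mul _ hH.det_pos.ne'.isUnit, trace_one,
      Fintype.card_fin]
  have hmin : IsLocalMin φ 0 := by
    have hc : Continuous fun t : ℝ => v + t • h := by fun_prop
    have hnear : ∀ᶠ t in nhds (0 : ℝ), v + t • h ∈ interior (polytope A b) :=
      hc.continuousAt.eventually_mem (isOpen_interior.mem_nhds (by simpa using hv.1))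
    filter_upwards [hnear] with t ht
    have hHt := posDef_hessian hbdd ht
    have h1 : volumetric A b v ≤ volumetric A b (v + t • h) := hv.2 ht
    have h2 : (hessian A b v).det ≤ (hessian A b (v + t • h)).det := by
      rw [← Real.log_le_log_iff hH.det_pos hHt.det_pos]
      simp only [volumetric] at h1
      linarith
    have h3 := h2.trans (hH.det_le_det_mul_exp hHt.posSemidef)
    rw [le_mul_iff_one_le_right hH.det_pos, Real.one_le_exp_iff, ← htrace, Fintype.card_fin] at h3
    linarith
  have hderiv : HasDerivAt φ
      (∑ i, -2 * (leverage A b v i * ((A i ⬝ᵥ h) / (A i ⬝ᵥ v - b i)))) 0 := by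
    refine HasDerivAt.fun_sum fun i _ => ?_
    by_cases hi : A i = 0
    · simpa [hi, hq] using hasDerivAt_const (0 : ℝ) (0 : ℝ)
    · have hs := slack_pos_of_mem_interior hv.1 hi
      simp only [dotProduct_add, dotProduct_smul, smul_eq_mul]
      have h1 : HasDerivAt (fun t : ℝ => A i ⬝ᵥ v + t * (A i ⬝ᵥ h) - b i) (A i ⬝ᵥ h) 0 := by
        simpa using (((hasDerivAt_id (0 : ℝ)).mul_const (A i ⬝ᵥ h)).const_add
          (A i ⬝ᵥ v)).sub_const (b i)
      have h2 := ((h1.fun_pow 2).fun_inv (by simpa using hs.ne')).mul_const (q i)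
      simp only [one_div]
      refine h2.congr_deriv ?_
      simp only [leverage, hq, zero_mul, add_zero]
      push_cast
      field_simp
  have := hmin.hasDerivAt_eq_zero hderiv
  rw [← Finset.mul_sum] at this
  linarith

/-! ### The outer ellipsoid -/

/-- Nonnegative weights `σ` of total mass `N` and `t ≥ -1` of `σ`-mean zero: if each `tᵢ²` is at
most `σᵢ ∑ tⱼ²`, then `∑ tⱼ²` is bounded, because the indices of small weight contribute
at most a fraction of it. -/
theorem sum_sq_le_of_sum_mul_eq_zero {N : ℝ} (hN : 1 ≤ N) {σ t : Fin m → ℝ} (hσ : ∀ i, 0 ≤ σ i)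
    (hsum : ∑ i, σ i = N) (ht : ∀ i, -1 ≤ t i) (hmean : ∑ i, σ i * t i = 0)
    (hsq : ∀ i, t i ^ 2 ≤ σ i * ∑ j, t j ^ 2) :
    ∑ i, t i ^ 2 ≤ 4 * (m : ℝ) ^ 3 * N ^ 2 := by
  -- The final estimate uses `1 ≤ 2m(m - 1)`, which fails for `m = 1`.
  rcases Nat.lt_or_ge m 2 with hm | hm
  · interval_cases m
    · simp
    · simp only [Fin.sum_univ_one] at *
      have : t 0 = 0 := (mul_eq_zero.1 hmean).resolve_left (by linarith)
      rw [this, zero_pow two_ne_zero]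
      positivity
  have hm' : (2 : ℝ) ≤ m := by exact_mod_cast hm
  set T := ∑ i, t i ^ 2
  have hT : 0 ≤ T := Finset.sum_nonneg fun i _ => sq_nonneg _
  set S := Finset.univ.filter fun i => σ i < 1 / (2 * m)
  set L := Finset.univ.filter fun i => ¬ σ i < 1 / (2 * m)
  have hsplit : ∑ i ∈ S, t i ^ 2 + ∑ i ∈ L, t i ^ 2 = T :=
    Finset.sum_filter_add_sum_filter_not _ _ _
  have hcard : S.card + L.card = m := by
    rw [Finset.card_filter_add_card_filter_not, Finset.card_univ, Fintype.card_fin]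
  -- If all weights were small, the total would be at most `1/2 < N`.
  have hL : 1 ≤ L.card := by
    rw [Nat.one_le_iff_ne_zero, Ne, Finset.card_eq_zero]
    intro hL
    have hall : ∀ i, σ i ≤ 1 / (2 * m) := fun i => by
      by_contra hi
      have : i ∈ L := Finset.mem_filter.2 ⟨Finset.mem_univ i, not_lt.2 (not_le.1 hi).le⟩
      simp [hL] at this
    have := Finset.sum_le_sum fun i (_ : i ∈ Finset.univ) => hall i
    rw [hsum, Finset.sum_const, Finset.card_univ, Fintype.card_fin, nsmul_eq_mul] at this
    have h2 : (m : ℝ) * (1 / (2 * m)) = 1 / 2 := by field_simp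
    linarith
  have hcard' : (S.card : ℝ) + L.card = m := by exact_mod_cast hcard
  have hL' : (1 : ℝ) ≤ L.card := by exact_mod_cast hL
  have hS : ∑ i ∈ S, t i ^ 2 ≤ (m - 1) / (2 * m) * T := by
    calc ∑ i ∈ S, t i ^ 2 ≤ ∑ i ∈ S, 1 / (2 * m) * T := Finset.sum_le_sum fun i hi =>
          (hsq i).trans (mul_le_mul_of_nonneg_right (Finset.mem_filter.1 hi).2.le hT)
      _ = S.card * (1 / (2 * m) * T) := by rw [Finset.sum_const, nsmul_eq_mul]
      _ ≤ (m - 1) * (1 / (2 * m) * T) := by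
          refine mul_le_mul_of_nonneg_right (by linarith) (by positivity)
      _ = _ := by ring
  have hu : ∀ i, 0 ≤ 1 + t i := fun i => by linarith [ht i]
  have hLu : ∑ i ∈ L, (1 + t i) ≤ 2 * m * N := by
    have h1 : ∑ i ∈ L, σ i * (1 + t i) ≤ N := by
      calc ∑ i ∈ L, σ i * (1 + t i) ≤ ∑ i, σ i * (1 + t i) :=
            Finset.sum_le_sum_of_subset_of_nonneg (Finset.subset_univ _)
              fun i _ _ => mul_nonneg (hσ i) (hu i)
        _ = N := by simp only [mul_add, mul_one, Finset.sum_add_distrib, hsum, hmean, add_zero]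
    have h2 : ∑ i ∈ L, 1 / (2 * m) * (1 + t i) ≤ ∑ i ∈ L, σ i * (1 + t i) :=
      Finset.sum_le_sum fun i hi =>
        mul_le_mul_of_nonneg_right (not_lt.1 (Finset.mem_filter.1 hi).2) (hu i)
    rw [← Finset.mul_sum, one_div] at h2
    exact (inv_mul_le_iff₀ (by positivity)).1 (h2.trans h1)
  have hLsq : ∑ i ∈ L, t i ^ 2 ≤ (2 * m * N) ^ 2 + m := by
    calc ∑ i ∈ L, t i ^ 2 ≤ ∑ i ∈ L, ((1 + t i) ^ 2 + 1) :=
          -- The difference of the two sides is `2 (1 + t i) ≥ 0`.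
          Finset.sum_le_sum fun i _ => by nlinarith [ht i]
      _ = ∑ i ∈ L, (1 + t i) ^ 2 + L.card := by simp [Finset.sum_add_distrib]
      _ ≤ (∑ i ∈ L, (1 + t i)) ^ 2 + L.card := by
          gcongr
          exact Finset.sum_sq_le_sq_sum_of_nonneg fun i _ => hu i
      _ ≤ (2 * m * N) ^ 2 + m := by
          have : 0 ≤ ∑ i ∈ L, (1 + t i) := Finset.sum_nonneg fun i _ => hu i
          have : (L.card : ℝ) ≤ m := by linarith [Nat.cast_nonneg (α := ℝ) S.card]
          gcongr
  have hmain : T * (m + 1) ≤ 2 * m * ((2 * m * N) ^ 2 + m) := by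
    have h1 : T ≤ (m - 1) / (2 * m) * T + ((2 * m * N) ^ 2 + m) := by linarith
    have h2 := mul_le_mul_of_nonneg_left h1 (by positivity : (0 : ℝ) ≤ 2 * m)
    have h3 : 2 * (m : ℝ) * ((m - 1) / (2 * m) * T + ((2 * m * N) ^ 2 + m)) =
        (m - 1) * T + 2 * m * ((2 * m * N) ^ 2 + m) := by field_simp
    linarith
  have hfin : 2 * (m : ℝ) * ((2 * m * N) ^ 2 + m) ≤ 4 * (m : ℝ) ^ 3 * N ^ 2 * (m + 1) := by
    have h1 : (1 : ℝ) ≤ N ^ 2 := one_le_pow₀ hN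
    have h2 : 2 * (m : ℝ) ^ 2 * 1 ≤ 2 * (m : ℝ) ^ 2 * (2 * m * (m - 1) * N ^ 2) := by
      refine mul_le_mul_of_nonneg_left ?_ (by positivity)
      have : (1 : ℝ) ≤ 2 * m * (m - 1) := by nlinarith
      nlinarith
    linarith
  exact le_of_mul_le_mul_right (hmain.trans hfin) (by positivity)

theorem polytope_subset_scaledEllipsoid (hbdd : Bornology.IsBounded (polytope A b))
    {v : Fin n → ℝ} (hv : IsVolumetricCenter A b v) :
    polytope A b ⊆ scaledEllipsoid (2 * (m : ℝ) ^ (3 / 2 : ℝ) * n) v (hessian A b v) := by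
  intro y hy
  have hH := posDef_hessian hbdd hv.1
  rcases Nat.eq_zero_or_pos n with rfl | hn
  -- The dilation factor vanishes for `n = 0`, so it cannot be inverted here.
  · exact ⟨y, ⟨by simp [nonzeroEigenspan_eq_top hH], by simp⟩, Subsingleton.elim _ _⟩
  have hN : (1 : ℝ) ≤ n := by exact_mod_cast hn
  have hm : 0 < m := by
    rcases Nat.eq_zero_or_pos m with rfl | hm
    · have := sum_leverage hH
      simp only [Finset.univ_eq_empty, Finset.sum_empty] at this
      linarith
    · exact hm
  have hT : ∑ i, ((A i ⬝ᵥ (y - v)) / (A i ⬝ᵥ v - b i)) ^ 2 ≤ 4 * (m : ℝ) ^ 3 * (n : ℝ) ^ 2 := by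
    refine sum_sq_le_of_sum_mul_eq_zero hN (leverage_nonneg hH) (sum_leverage hH) (fun i => ?_)
      (sum_leverage_mul_div_slack_eq_zero hbdd hv _) fun i => ?_
    · by_cases hi : A i = 0
      · simp [hi]
      · rw [le_div_iff₀ (slack_pos_of_mem_interior hv.1 hi), dotProduct_sub]
        linarith [hy i]
    · rw [← dotProduct_hessian_mulVec]
      exact sq_div_slack_le hH _ i
  set c : ℝ := 2 * (m : ℝ) ^ (3 / 2 : ℝ) * n
  have hc : 0 < c := by positivity
  have hc2 : c ^ 2 = 4 * (m : ℝ) ^ 3 * (n : ℝ) ^ 2 := by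
    have h : ((m : ℝ) ^ (3 / 2 : ℝ)) ^ 2 = (m : ℝ) ^ 3 := by
      rw [← Real.rpow_natCast, ← Real.rpow_mul (by positivity), ← Real.rpow_natCast]
      norm_num
    rw [mul_pow, mul_pow, h]
    norm_num
  refine ⟨v + c⁻¹ • (y - v), ⟨by simp [nonzeroEigenspan_eq_top hH], ?_⟩, ?_⟩
  · rw [add_sub_cancel_left, mulVec_smul, dotProduct_smul, smul_dotProduct, smul_eq_mul,
      smul_eq_mul, dotProduct_hessian_mulVec, ← mul_assoc, ← sq, inv_pow,
      inv_mul_le_iff₀ (by positivity), mul_one, hc2]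
    exact hT
  · simp only [add_sub_cancel_left, smul_smul]
    rw [mul_inv_cancel₀ hc.ne', one_smul, add_sub_cancel]

end LogBarrier

theorem lemma4p5 {m n : ℕ} (A : Matrix (Fin m) (Fin n) ℝ) (b : Fin m → ℝ)
    (hbdd : Bornology.IsBounded (LogBarrier.polytope A b))
    (hfull : (interior (LogBarrier.polytope A b)).Nonempty) :
    (∀ x ∈ interior (LogBarrier.polytope A b),
      LogBarrier.ellipsoid x (LogBarrier.hessian A b x) ⊆ LogBarrier.polytope A b) ∧
    (∃ v, LogBarrier.IsVolumetricCenter A b v) ∧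
    (∀ v, LogBarrier.IsVolumetricCenter A b v →
      LogBarrier.polytope A b ⊆
        LogBarrier.scaledEllipsoid (2 * (m : ℝ) ^ (3 / 2 : ℝ) * n) v
          (LogBarrier.hessian A b v)) := by
  exact ⟨fun _ hx => LogBarrier.ellipsoid_subset_polytope hx,
    LogBarrier.exists_isVolumetricCenter hbdd hfull,
    fun _ hv => LogBarrier.polytope_subset_scaledEllipsoid hbdd hv⟩
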